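/- Let $G$ be a finitely generated torsion-free nilpotent group, let $c$ be a central element of $G$ with $c\neq e$, and let $K$ be a subgroup of $G$. We say that $K$ is a \emph{stabilizer subgroup} of $c$ if $c\in K$ and the following two conditions hold: (1) there is a normal subgroup $H\triangleleft K$ such that $K/H\simeq\mathbb{Z}$ and $H\cap\langle c\rangle=\{e\}$; (2) there are an integer $n\ge 0$ and a finite chain of subgroups of $G$ $$K=K_n\triangleleft K_{n-1}\triangleleft\cdots\triangleleft K_0=G$$ such that $K_i/K_{i+1}\simeq\mathbb{Z}$ for all $0\le i<n$. An action of $G$ on $[0,1]$ by orientation-preserving homeomorphisms is a group homomorphism $\phi\colon G\to\mathrm{Homeo}_+([0,1])$ (not necessarily injective). A \emph{support interval} of $c$ for such an action is the closure of a connected component of $[0,1]\setminus\mathrm{Fix}(\phi(c))$, and for a support interval $J$ one puts $\mathrm{Stab}(J)=\{g\in G : \phi(g)(J)=J\}$. Then $K$ is a stabilizer subgroup of $c$ if and only if there exist an action of $G$ on $[0,1]$ by orientation-preserving homeomorphisms and a support interval $J$ of $c$ for this action such that $\mathrm{Stab}(J)=K$. -/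

import Mathlib

/-- `A ◁ B` with `B / A` infinite cyclic, for subgroups `A`, `B` of `G`. -/
def IsInfCyclicStep {G : Type*} [Group G] (A B : Subgroup G) : Prop :=
  A ≤ B ∧ ∃ _ : (A.subgroupOf B).Normal,
    Nonempty ((B ⧸ A.subgroupOf B) ≃* Multiplicative ℤ)

/-- `K` is a stabilizer subgroup of `c`, in the algebraic sense. The notion is used for a
nontrivial central element `c` of a finitely generated torsion-free nilpotent group `G`. -/
structure IsStabilizerSubgroup {G : Type*} [Group G] (K : Subgroup G) (c : G) : Prop where
  mem : c ∈ K
  /-- `K / H ≃ ℤ` for some normal subgroup `H` of `K` that meets `⟨c⟩` trivially. -/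
  exists_quotient : ∃ (H : Subgroup K) (_ : H.Normal),
    Nonempty ((K ⧸ H) ≃* Multiplicative ℤ) ∧
      H.map K.subtype ⊓ Subgroup.zpowers c = ⊥
  /-- There is a chain `K = L n ◁ L (n - 1) ◁ ⋯ ◁ L 0 = G` with all quotients `≃ ℤ`
  (`n = 0` is allowed; the values of `L` beyond `n` play no role). -/
  exists_chain : ∃ (n : ℕ) (L : ℕ → Subgroup G),
    L 0 = ⊤ ∧ L n = K ∧ ∀ i < n, IsInfCyclicStep (L (i + 1)) (L i)

/-- The group of orientation-preserving homeomorphisms of `[0,1]`. -/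
def HomeoPlus : Subgroup (unitInterval ≃ₜ unitInterval) where
  carrier := {f | StrictMono f}
  mul_mem' := fun {f g} hf hg => StrictMono.comp (g := ⇑f) (f := ⇑g) hf hg
  one_mem' := fun _ _ h => h
  inv_mem' := fun {f} hf a b hab => by
    have hf' : StrictMono f := hf
    refine hf'.lt_iff_lt.mp ?_
    change f (f.symm a) < f (f.symm b)
    simpa using hab

/-- `J` is a support interval of `f`: the closure of a connected component of the complement
of the set of fixed points of `f`. -/
def IsSupportInterval (f : unitInterval ≃ₜ unitInterval) (J : Set unitInterval) : Prop :=
  ∃ x ∈ (Function.fixedPoints f)ᶜ,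
    J = closure (connectedComponentIn (Function.fixedPoints f)ᶜ x)

/-- The (setwise) stabilizer of `J` under an action `φ` of `G` on `[0,1]`. -/
def intervalStab {G : Type*} [Group G] (φ : G →* HomeoPlus) (J : Set unitInterval) :
    Subgroup G where
  carrier := {g | (φ g).1 '' J = J}
  mul_mem' := fun {a b} ha hb => by
    have ha' : (φ a).1 '' J = J := ha
    have hb' : (φ b).1 '' J = J := hb
    change (φ (a * b)).1 '' J = J
    have h : ⇑(φ (a * b)).1 = ⇑(φ a).1 ∘ ⇑(φ b).1 := by
      rw [map_mul]; rfl
    rw [h, Set.image_comp, hb', ha']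
  one_mem' := by
    change (φ 1).1 '' J = J
    have h : ⇑(φ (1 : G)).1 = id := by
      rw [map_one]; rfl
    rw [h, Set.image_id]
  inv_mem' := fun {a} ha => by
    have ha' : (φ a).1 '' J = J := ha
    change (φ a⁻¹).1 '' J = J
    have h : ⇑(φ a⁻¹).1 ∘ ⇑(φ a).1 = id := by
      have h1 : φ a⁻¹ * φ a = 1 := by rw [← map_mul, inv_mul_cancel, map_one]
      exact congrArg (fun f : HomeoPlus => ⇑f.1) h1
    conv_lhs => rw [← ha']
    rw [← Set.image_comp, h, Set.image_id]

/-! Both directions reduce to order. The fixed points of the central `c` form a `G`-invariant set,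
so `g` stabilizes the support interval around `x` exactly when no fixed point of `c` lies between
`x` and `g x` (`mem_intervalStab_iff`).

From an action to the algebra: on the `K`-orbit of `x` the powers of `c` are cofinal, so counting
`c`-steps from `x` to `g x` gives an integer quasimorphism on `K`. On a nilpotent group its
homogenization is a homomorphism (`map_mul_of_homogeneous_quasimorphism`), whence a real character
that is nonzero at `c`; finite generation of `K` turns it into a surjection to `ℤ`, whose kernel is
`H`. Monotonicity makes `K` closed under roots, and such a subgroup is reached from `G` by infinite
cyclic steps (`exists_chain_of_root_closed`).

From the algebra to an action: the chain orders `G ⧸ K` lexicographically, and `K / H ≃ ℤ` refines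
this to a left-invariant order on the cosets of `H`, in which `K / H` is a convex block with the
powers of `c` cofinal (`IsStabilizerSubgroup.exists_linearOrder`). This countable ordered set embeds
equivariantly in `[0,1]` (`exists_realization`). There `c` fixes the supremum of the block and no
point between two of its members, so the stabilizer is `K`. -/

open scoped commutatorElement

/-! ### Polycyclic structure of finitely generated nilpotent groups -/

section CyclicNormalSeries

theorem Subgroup.exists_eq_zpowers_of_le_zpowers {G : Type*} [Group G] {L : Subgroup G} {g : G}
    (h : L ≤ Subgroup.zpowers g) : ∃ y, L = Subgroup.zpowers y := by
  have hr : L ≤ (zpowersHom G g).range := fun x hx => by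
    obtain ⟨n, rfl⟩ := h hx
    exact ⟨Multiplicative.ofAdd n, by simp⟩
  obtain ⟨k, hk⟩ := (Subgroup.isCyclic_iff_exists_zpowers_eq_top (L.comap (zpowersHom G g))).mp
    inferInstance
  exact ⟨zpowersHom G g k, by
    rw [← MonoidHom.map_zpowers, hk, Subgroup.map_comap_eq, inf_eq_right.mpr hr]⟩

variable {G : Type*} [Group G]

/-- `N` is reached from `⊥` by adjoining one element at a time, every proper intermediate subgroup
being normal in `G`. -/
inductive HasCyclicNormalSeries : Subgroup G → Prop
  | bot : HasCyclicNormalSeries ⊥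
  | sup_zpowers {N : Subgroup G} (t : G) (hN : HasCyclicNormalSeries N) (hn : N.Normal) :
      HasCyclicNormalSeries (N ⊔ Subgroup.zpowers t)

theorem Subgroup.mem_sup_zpowers_of_normal {N : Subgroup G} [N.Normal] {t x : G} :
    x ∈ N ⊔ Subgroup.zpowers t ↔ ∃ z ∈ N, ∃ n : ℤ, x = z * t ^ n := by
  rw [Subgroup.mem_sup_of_normal_left]
  constructor
  · rintro ⟨z, hz, _, ⟨n, rfl⟩, rfl⟩
    exact ⟨z, hz, n, rfl⟩
  · rintro ⟨z, hz, n, rfl⟩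
    exact ⟨z, hz, _, ⟨n, rfl⟩, rfl⟩

/-- At each step the image of `L` modulo `N` is cyclic, so `L` needs only one generator more than `L
⊓ N`. -/
theorem HasCyclicNormalSeries.fg_of_le {N : Subgroup G} (hN : HasCyclicNormalSeries N) :
    ∀ L ≤ N, L.FG := by
  induction hN with
  | bot =>
    intro L hL
    rw [le_bot_iff.mp hL]
    exact Subgroup.FG.bot
  | @sup_zpowers N t _ hn ih =>
    intro L hL
    have hle : L.map (QuotientGroup.mk' N) ≤ Subgroup.zpowers (QuotientGroup.mk' N t) := by
      refine (Subgroup.map_mono hL).trans ?_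
      rw [Subgroup.map_sup, MonoidHom.map_zpowers]
      simp
    obtain ⟨d', hd'⟩ := Subgroup.exists_eq_zpowers_of_le_zpowers hle
    obtain ⟨d, hdL, rfl⟩ : d' ∈ L.map (QuotientGroup.mk' N) := by
      rw [hd']; exact Subgroup.mem_zpowers _
    have : L = (L ⊓ N) ⊔ Subgroup.zpowers d := by
      apply le_antisymm
      · intro x hx
        have hx' : QuotientGroup.mk' N x ∈ Subgroup.zpowers (QuotientGroup.mk' N d) := by
          rw [← hd']; exact Subgroup.mem_map_of_mem _ hx
        obtain ⟨n, hn'⟩ := hx'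
        have h1 : x * (d ^ n)⁻¹ ∈ N := by
          rw [← QuotientGroup.eq_one_iff]
          have : (QuotientGroup.mk' N d) ^ n = QuotientGroup.mk' N x := hn'
          change QuotientGroup.mk' N (x * (d ^ n)⁻¹) = 1
          rw [map_mul, map_inv, map_zpow, this, mul_inv_cancel]
        have h2 : x = x * (d ^ n)⁻¹ * d ^ n := by group
        rw [h2]
        exact Subgroup.mul_mem_sup ⟨L.mul_mem hx (L.inv_mem (L.zpow_mem hdL n)), h1⟩
          ⟨n, rfl⟩
      · exact sup_le inf_le_left (by simpa using hdL)
    rw [this]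
    exact (ih _ inf_le_right).sup (by
      rw [Subgroup.zpowers_eq_closure]
      exact ⟨{d}, by simp⟩)

theorem HasCyclicNormalSeries.countable {N : Subgroup G} (hN : HasCyclicNormalSeries N) :
    Countable N := by
  induction hN with
  | bot => infer_instance
  | @sup_zpowers N t _ hn ih =>
    let f : N × ℤ → (N ⊔ Subgroup.zpowers t : Subgroup G) := fun p =>
      ⟨p.1 * t ^ p.2, Subgroup.mul_mem_sup p.1.2 ⟨p.2, rfl⟩⟩
    refine Function.Surjective.countable (f := f) ?_
    rintro ⟨x, hx⟩
    obtain ⟨z, hz, n, rfl⟩ := Subgroup.mem_sup_zpowers_of_normal.mp hx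
    exact ⟨(⟨z, hz⟩, n), rfl⟩

/-- A length function on subgroups which is strictly monotone along inclusions of root-closed
subgroups. -/
theorem HasCyclicNormalSeries.exists_rank {N : Subgroup G} (hN : HasCyclicNormalSeries N) :
    ∃ r : Subgroup G → ℕ, Monotone r ∧ ∀ L M : Subgroup G, L ≤ M →
      (∀ g ∈ M, ∀ n : ℕ, 0 < n → g ^ n ∈ L → g ∈ L) → r L = r M → M ⊓ N ≤ L := by
  classical
  induction hN with
  | bot => exact ⟨fun _ => 0, fun _ _ _ => le_rfl, fun L M _ _ _ => by simp⟩
  | @sup_zpowers N t _ hn ih =>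
    obtain ⟨r, hr, hrs⟩ := ih
    -- A layer counts for `L` when `L` has an element in it of infinite order modulo `N`; the
    -- resulting sum is the Hirsch length.
    let P : Subgroup G → Prop := fun L =>
      ∃ x ∈ L ⊓ (N ⊔ Subgroup.zpowers t), ∀ n : ℕ, 0 < n → x ^ n ∉ N
    have hP : ∀ L M, L ≤ M → P L → P M := by
      rintro L M h ⟨x, hx, hx'⟩
      exact ⟨x, ⟨h hx.1, hx.2⟩, hx'⟩
    refine ⟨fun L => r L + if P L then 1 else 0, fun L M h => ?_, fun L M h hroot heq => ?_⟩
    · have h1 := hr h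
      have h2 := hP L M h
      dsimp only
      split_ifs with h3 h4 <;> first | omega | exact absurd (h2 h3) h4
    · have h1 := hr h
      have h2 := hP L M h
      have h3 : r L = r M ∧ (P M → P L) := by
        dsimp only at heq
        split_ifs at heq with h3 h4 h4
        · exact ⟨by omega, fun _ => h3⟩
        · exact absurd (h2 h3) h4
        · omega
        · exact ⟨by omega, fun h => absurd h h4⟩
      have hMN := hrs L M h hroot h3.1
      rintro g ⟨hgM, hgN⟩
      by_cases hg : ∃ n : ℕ, 0 < n ∧ g ^ n ∈ N
      · obtain ⟨n, hn0, hgn⟩ := hg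
        exact hroot g hgM n hn0 (hMN ⟨M.pow_mem hgM n, hgn⟩)
      · push Not at hg
        obtain ⟨x, ⟨hxL, hxN⟩, hx⟩ := h3.2 ⟨g, ⟨hgM, hgN⟩, hg⟩
        obtain ⟨z, hz, b, rfl⟩ := Subgroup.mem_sup_zpowers_of_normal.mp hgN
        obtain ⟨w, hw, a, rfl⟩ := Subgroup.mem_sup_zpowers_of_normal.mp hxN
        have hmk : ∀ z ∈ N, (QuotientGroup.mk' N) z = 1 := fun z hz =>
          (QuotientGroup.eq_one_iff z).mpr hz
        have ha : a ≠ 0 := by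
          rintro rfl
          exact hx 1 one_pos (by simpa using hw)
        -- Modulo `N` both powers equal `t ^ (a * b)`; the second lies in `L`, so `g ^ a` does too,
        -- and root-closedness applies.
        have key : (z * t ^ b) ^ a * ((w * t ^ a) ^ b)⁻¹ ∈ N := by
          rw [← QuotientGroup.eq_one_iff]
          change QuotientGroup.mk' N _ = 1
          simp only [map_mul, map_inv, map_zpow, hmk z hz, hmk w hw, one_mul]
          rw [← zpow_mul, ← zpow_mul, mul_comm a b, mul_inv_cancel]
        have h5 : (z * t ^ b) ^ a ∈ L := by
          have h6 := L.mul_mem (hMN ⟨M.mul_mem (M.zpow_mem hgM a)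
            (M.inv_mem (M.zpow_mem (h hxL) b)), key⟩) (L.zpow_mem hxL b)
          simpa using h6
        refine hroot _ hgM a.natAbs (by omega) ?_
        rcases Int.natAbs_eq a with h7 | h7
        · rwa [h7, zpow_natCast] at h5
        · rw [h7, zpow_neg, zpow_natCast] at h5
          exact inv_mem_iff.mp h5

/-- Every subgroup between `N` and `M` is normal because `⁅M, G⁆ ≤ N`, so the generators can be
adjoined one by one. -/
theorem HasCyclicNormalSeries.sup_closure {N M : Subgroup G} (hN : HasCyclicNormalSeries N)
    (hNM : N ≤ M) (hM : ⁅M, (⊤ : Subgroup G)⁆ ≤ N) (T : Finset G) (hT : (T : Set G) ⊆ M) :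
    HasCyclicNormalSeries (N ⊔ Subgroup.closure (T : Set G)) := by
  classical
  have hnormal : ∀ L, N ≤ L → L ≤ M → L.Normal := fun L h1 h2 => ⟨fun x hx g => by
    have h3 : ⁅x, g⁆ ∈ L := h1 (hM (Subgroup.commutator_mem_commutator (h2 hx) (Subgroup.mem_top _)))
    have h4 : g * x * g⁻¹ = (⁅x, g⁆⁻¹) * x := by simp [commutatorElement_def, mul_assoc]
    rw [h4]
    exact L.mul_mem (L.inv_mem h3) hx⟩
  induction T using Finset.induction_on with
  | empty => simpa using hN
  | @insert t T _ ih =>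
    have h1 : (T : Set G) ⊆ M := fun x hx => hT (by simp [Finset.mem_coe.mp hx])
    have h2 := (ih h1).sup_zpowers t (hnormal _ le_sup_left
      (sup_le hNM ((Subgroup.closure_le _).mpr h1)))
    convert h2 using 1
    rw [Finset.coe_insert, ← Set.union_singleton, Subgroup.closure_union, sup_assoc,
      Subgroup.zpowers_eq_closure]

/-- Each layer is generated by commutators of generators of the previous layer with generators of
`G`: modulo these and the next term, every generator of `G` commutes with the previous term, hence
all of `G` does. -/
theorem exists_finset_lowerCentralSeries [Group.FG G] (n : ℕ) :
    ∃ T : Finset G, Subgroup.lowerCentralSeries (⊤ : Subgroup G) n =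
      Subgroup.lowerCentralSeries (⊤ : Subgroup G) (n + 1) ⊔ Subgroup.closure (T : Set G) := by
  classical
  obtain ⟨S, hS⟩ := Group.fg_def.mp ‹Group.FG G›
  induction n with
  | zero =>
    exact ⟨S, by rw [hS]; simp⟩
  | succ n ih =>
    obtain ⟨T, hT⟩ := ih
    set γ := Subgroup.lowerCentralSeries (⊤ : Subgroup G) with hγ
    have hγs : ∀ k, γ (k + 1) = ⁅γ k, ⊤⁆ := fun k => rfl
    have hTn : (T : Set G) ⊆ γ n := by
      rw [hT]; exact Subgroup.subset_closure.trans (SetLike.coe_subset_coe.mpr le_sup_right)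
    let U : Finset G := (T ×ˢ S).image fun p => ⁅p.1, p.2⁆
    have hU : (U : Set G) ⊆ γ (n + 1) := by
      intro u hu
      obtain ⟨p, hp, rfl⟩ := Finset.mem_image.mp (Finset.mem_coe.mp hu)
      exact Subgroup.commutator_mem_commutator (hTn (Finset.mem_product.mp hp).1) trivial
    refine ⟨U, ?_⟩
    set M := γ (n + 1 + 1) ⊔ Subgroup.closure (U : Set G) with hMdef
    have hanti : γ (n + 1 + 1) ≤ γ (n + 1) :=
      Subgroup.lowerCentralSeries_antitone _ (Nat.le_succ _)
    have hle : M ≤ γ (n + 1) := sup_le hanti ((Subgroup.closure_le _).mpr hU)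
    refine le_antisymm ?_ hle
    have hMn : M.Normal := ⟨fun x hx g => by
      have h3 : ⁅x, g⁆ ∈ M :=
        le_sup_left (a := γ (n + 1 + 1)) (Subgroup.commutator_mem_commutator (hle hx) (Subgroup.mem_top _))
      have h4 : g * x * g⁻¹ = (⁅x, g⁆⁻¹) * x := by simp [commutatorElement_def, mul_assoc]
      rw [h4]
      exact M.mul_mem (M.inv_mem h3) hx⟩
    let q := QuotientGroup.mk' M
    have hq : ∀ x y, ⁅x, y⁆ ∈ M ↔ q x * q y = q y * q x := fun x y => by
      rw [← QuotientGroup.eq_one_iff]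
      change q ⁅x, y⁆ = 1 ↔ _
      rw [map_commutatorElement, commutatorElement_eq_one_iff_mul_comm]
    have hx : ∀ s ∈ S, ∀ x ∈ γ n, q x * q s = q s * q x := by
      intro s hs
      have : γ n ≤ (Subgroup.centralizer {q s}).comap q := by
        rw [hT]
        refine sup_le (fun x hx => ?_) ((Subgroup.closure_le _).mpr fun x hx => ?_)
        · rw [Subgroup.mem_comap, Subgroup.mem_centralizer_singleton_iff]
          exact (hq _ _).mp (le_sup_left (a := γ (n + 1 + 1))
            (Subgroup.commutator_mem_commutator hx (Subgroup.mem_top _)))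
        · rw [SetLike.mem_coe, Subgroup.mem_comap, Subgroup.mem_centralizer_singleton_iff]
          exact (hq _ _).mp (le_sup_right (a := γ (n + 1 + 1)) (Subgroup.subset_closure
            (Finset.mem_coe.mpr (Finset.mem_image.mpr
              ⟨(x, s), Finset.mem_product.mpr ⟨hx, hs⟩, rfl⟩))))
      intro x hx
      have := this hx
      rwa [Subgroup.mem_comap, Subgroup.mem_centralizer_singleton_iff] at this
    rw [hγs, Subgroup.commutator_le]
    intro x hxn g _
    have : (⊤ : Subgroup G) ≤ (Subgroup.centralizer {q x}).comap q := by
      rw [← hS, Subgroup.closure_le]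
      intro s hs
      rw [SetLike.mem_coe, Subgroup.mem_comap, Subgroup.mem_centralizer_singleton_iff]
      exact (hx s hs x hxn).symm
    have h5 := this (Subgroup.mem_top g)
    rw [Subgroup.mem_comap, Subgroup.mem_centralizer_singleton_iff] at h5
    exact (hq _ _).mpr h5.symm

theorem HasCyclicNormalSeries.top [Group.FG G] [Group.IsNilpotent G] :
    HasCyclicNormalSeries (⊤ : Subgroup G) := by
  obtain ⟨n, hn⟩ := Subgroup.nilpotent_iff_lowerCentralSeries.mp ‹Group.IsNilpotent G›
  have : ∀ k ≤ n, HasCyclicNormalSeries (Subgroup.lowerCentralSeries (⊤ : Subgroup G) (n - k)) := by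
    intro k
    induction k with
    | zero => intro _; simpa [hn] using HasCyclicNormalSeries.bot
    | succ k ih =>
      intro hk
      obtain ⟨T, hT⟩ := exists_finset_lowerCentralSeries (G := G) (n - (k + 1))
      have h1 := ih (by omega)
      rw [show n - k = n - (k + 1) + 1 by omega] at h1
      rw [hT]
      refine h1.sup_closure (Subgroup.lowerCentralSeries_antitone _ (Nat.le_succ _)) le_rfl T ?_
      rw [hT]
      exact Subgroup.subset_closure.trans (SetLike.coe_subset_coe.mpr le_sup_right)
  simpa using this n le_rfl

end CyclicNormalSeries

theorem Group.FG.subgroup_of_isNilpotent {G : Type*} [Group G] [Group.FG G] [Group.IsNilpotent G]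
    (K : Subgroup G) : Group.FG K :=
  (Group.fg_iff_subgroup_fg K).mpr (HasCyclicNormalSeries.top.fg_of_le K le_top)

theorem Group.FG.countable_of_isNilpotent {G : Type*} [Group G] [Group.FG G]
    [Group.IsNilpotent G] : Countable G :=
  have := (HasCyclicNormalSeries.top (G := G)).countable
  Subgroup.topEquiv.toEquiv.countable_iff.mp this

/-! ### Root-closed subgroups and infinite cyclic chains -/

section RootClosed

theorem commutatorElement_pow_right {G : Type*} [Group G] {x y : G} (h : Commute ⁅x, y⁆ y)
    (n : ℕ) : ⁅x, y ^ n⁆ = ⁅x, y⁆ ^ n := by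
  have h1 : x * y * x⁻¹ = ⁅x, y⁆ * y := by simp [commutatorElement_def]
  have h2 : x * y ^ n * x⁻¹ = ⁅x, y⁆ ^ n * y ^ n := by
    rw [← conj_pow, h1, h.mul_pow]
  rw [commutatorElement_def x (y ^ n), h2, mul_inv_cancel_right]

theorem commutatorElement_mul_right_of_mem_center {G : Type*} [Group G] {x y z : G}
    (hz : z ∈ Subgroup.center G) : ⁅x, y * z⁆ = ⁅x, y⁆ := by
  have h := Subgroup.mem_center_iff.mp hz x⁻¹
  simp only [commutatorElement_def, mul_inv_rev, mul_assoc]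
  rw [← mul_assoc z x⁻¹, ← h]
  group

/-- Induction on the class. Modulo the last term `Γ`, which is central, `x ^ a` and `y ^ b` lie in
`K`; when `⁅x, y⁆` is central, bilinearity puts `⁅x, y⁆ ^ (b * a)` in `K`. Such commutators generate
`Γ`, so elements of `Γ` also have powers in `K`. -/
theorem exists_pow_mem_of_lowerCentralSeries_eq_bot (n : ℕ) :
    ∀ {G : Type*} [Group G], Subgroup.lowerCentralSeries (⊤ : Subgroup G) n = ⊥ →
      ∀ K : Subgroup G, (∀ g : G, ∃ m : ℕ, 0 < m ∧ g ^ m ∈ K ⊔ commutator G) →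
        ∀ g : G, ∃ m : ℕ, 0 < m ∧ g ^ m ∈ K := by
  induction n with
  | zero =>
    intro G _ h K _ g
    refine ⟨1, one_pos, ?_⟩
    have : g ∈ (⊥ : Subgroup G) := h ▸ Subgroup.mem_top g
    rw [Subgroup.mem_bot.mp this]
    simp
  | succ n ih =>
    intro G _ h K hK
    -- The abelian case is separate: there the last nontrivial term is not generated by commutators.
    rcases n with _ | n
    · have h1 : commutator G = ⊥ := by rw [← Subgroup.top_lowerCentralSeries_one]; exact h
      simpa [h1] using hK
    set Γ := Subgroup.lowerCentralSeries (⊤ : Subgroup G) (n + 1) with hΓ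
    have hcen : Γ ≤ Subgroup.center G := by
      rw [← Subgroup.centralizer_univ, ← Subgroup.coe_top,
        ← Subgroup.commutator_eq_bot_iff_le_centralizer]
      exact h
    let q := QuotientGroup.mk' Γ
    have hq : Function.Surjective q := QuotientGroup.mk'_surjective Γ
    have hbot : Subgroup.lowerCentralSeries (⊤ : Subgroup (G ⧸ Γ)) (n + 1) = ⊥ := by
      rw [← Subgroup.map_top_of_surjective q hq, ← Subgroup.map_lowerCentralSeries,
        Subgroup.map_eq_bot_iff, QuotientGroup.ker_mk']
    have hroot : ∀ g : G, ∃ m : ℕ, 0 < m ∧ ∃ k ∈ K, ∃ z ∈ Γ, g ^ m = k * z := by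
      intro g
      obtain ⟨m, hm, hgm⟩ := ih hbot (K.map q) (fun g' => by
        obtain ⟨g, rfl⟩ := hq g'
        obtain ⟨m, hm, hgm⟩ := hK g
        refine ⟨m, hm, ?_⟩
        have h1 := Subgroup.mem_map_of_mem q hgm
        rw [map_pow, Subgroup.map_sup, commutator_def, Subgroup.map_commutator,
          Subgroup.map_top_of_surjective q hq] at h1
        exact h1) (q g)
      obtain ⟨k, hk, hkg⟩ := hgm
      refine ⟨m, hm, k, hk, k⁻¹ * g ^ m, ?_, by group⟩
      rw [← QuotientGroup.eq_one_iff]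
      change q _ = 1
      rw [map_mul, map_inv, map_pow, hkg, inv_mul_cancel]
    let T : Subgroup G :=
      { carrier := {z | z ∈ Subgroup.center G ∧ ∃ m : ℕ, 0 < m ∧ z ^ m ∈ K}
        one_mem' := ⟨one_mem _, 1, one_pos, by simp⟩
        mul_mem' := by
          rintro a b ⟨ha, m, hm, ham⟩ ⟨hb, l, hl, hbl⟩
          refine ⟨mul_mem ha hb, m * l, Nat.mul_pos hm hl, ?_⟩
          have hab : Commute a b := Subgroup.mem_center_iff.mp hb a
          rw [hab.mul_pow, pow_mul, mul_comm m l, pow_mul]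
          exact K.mul_mem (K.pow_mem ham _) (K.pow_mem hbl _)
        inv_mem' := by
          rintro a ⟨ha, m, hm, ham⟩
          exact ⟨inv_mem ha, m, hm, by rw [inv_pow]; exact K.inv_mem ham⟩ }
    have hT : Γ ≤ T := by
      have : Γ = ⁅Subgroup.lowerCentralSeries (⊤ : Subgroup G) n, ⊤⁆ := rfl
      rw [this, Subgroup.commutator_le]
      intro x hx y _
      have hz : ⁅x, y⁆ ∈ Subgroup.center G :=
        hcen (Subgroup.commutator_mem_commutator hx (Subgroup.mem_top _))
      refine ⟨hz, ?_⟩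
      obtain ⟨a, ha, k₁, hk₁, z₁, hz₁, hxa⟩ := hroot x
      obtain ⟨b, hb, k₂, hk₂, z₂, hz₂, hyb⟩ := hroot y
      have h1 : ⁅x, y⁆ ^ b = ⁅x, k₂⁆ := by
        rw [← commutatorElement_pow_right (Subgroup.mem_center_iff.mp hz y).symm, hyb,
          commutatorElement_mul_right_of_mem_center (hcen hz₂)]
      have h2 : ⁅k₂, x⁆ ∈ Subgroup.center G := by
        rw [← commutatorElement_inv, ← h1]
        exact inv_mem (pow_mem hz b)
      have h3 : ⁅k₂, x⁆ ^ a = ⁅k₂, k₁⁆ := by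
        rw [← commutatorElement_pow_right (Subgroup.mem_center_iff.mp h2 x).symm, hxa,
          commutatorElement_mul_right_of_mem_center (hcen hz₁)]
      refine ⟨b * a, Nat.mul_pos hb ha, ?_⟩
      rw [pow_mul, h1, ← commutatorElement_inv, inv_pow, h3, commutatorElement_def]
      exact K.inv_mem (K.mul_mem (K.mul_mem (K.mul_mem hk₂ hk₁) (K.inv_mem hk₂)) (K.inv_mem hk₁))
    intro g
    obtain ⟨m, hm, k, hk, z, hz, hgm⟩ := hroot g
    obtain ⟨hzc, l, hl, hzl⟩ := hT hz
    refine ⟨m * l, Nat.mul_pos hm hl, ?_⟩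
    have hkz : Commute k z := Subgroup.mem_center_iff.mp hzc k
    rw [pow_mul, hgm, hkz.mul_pow]
    exact K.mul_mem (K.pow_mem hk l) hzl

theorem exists_pow_mem_of_isNilpotent {G : Type*} [Group G] [Group.IsNilpotent G] (K : Subgroup G)
    (hK : ∀ g : G, ∃ m : ℕ, 0 < m ∧ g ^ m ∈ K ⊔ commutator G) (g : G) :
    ∃ m : ℕ, 0 < m ∧ g ^ m ∈ K := by
  obtain ⟨n, hn⟩ := Subgroup.nilpotent_iff_lowerCentralSeries.mp ‹Group.IsNilpotent G›
  exact exists_pow_mem_of_lowerCentralSeries_eq_bot n hn K hK g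

theorem AddCommGroup.exists_surjective_int_hom {A : Type*} [AddCommGroup A] [Module.Finite ℤ A]
    {a : A} (ha : ∀ n : ℕ, 0 < n → n • a ≠ 0) :
    ∃ f : A →+ ℤ, Function.Surjective f ∧ f a ≠ 0 := by
  let T := Submodule.torsion ℤ A
  let b := Module.Free.chooseBasis ℤ (A ⧸ T)
  have ha' : T.mkQ a ≠ 0 := by
    rw [Submodule.mkQ_apply, Ne, Submodule.Quotient.mk_eq_zero, Submodule.mem_torsion_iff]
    rintro ⟨n, hn⟩
    have hn0 : (n : ℤ) ≠ 0 := nonZeroDivisors.coe_ne_zero n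
    have hna : (n : ℤ) • a = 0 := hn
    refine ha (n : ℤ).natAbs (by omega) ?_
    rw [← natCast_zsmul]
    rcases Int.natAbs_eq (n : ℤ) with h | h
    · rw [← h, hna]
    · rw [show (((n : ℤ).natAbs : ℕ) : ℤ) = -(n : ℤ) by omega, neg_smul, hna, neg_zero]
  obtain ⟨i, hi⟩ : ∃ i, b.repr (T.mkQ a) i ≠ 0 := by
    by_contra! h
    exact ha' (b.repr.map_eq_zero_iff.mp (Finsupp.ext h))
  refine ⟨((b.coord i).comp T.mkQ).toAddMonoidHom, fun n => ?_, hi⟩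
  obtain ⟨x, hx⟩ := T.mkQ_surjective (n • b i)
  exact ⟨x, by simp [hx]⟩

theorem exists_surjective_int_hom {G : Type*} [Group G] [Group.FG G] {N : Subgroup G}
    (hN : commutator G ≤ N) {a : G} (ha : ∀ n : ℕ, 0 < n → a ^ n ∉ N) :
    ∃ f : G →* Multiplicative ℤ, Function.Surjective f ∧ N ≤ f.ker ∧ f a ≠ 1 := by
  have hn : N.Normal := ⟨fun x hx g => by
    have h4 : g * x * g⁻¹ = ⁅g, x⁆ * x := by simp [commutatorElement_def]
    rw [h4]
    exact N.mul_mem (hN (Subgroup.commutator_mem_commutator (Subgroup.mem_top _)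
      (Subgroup.mem_top _))) hx⟩
  let _ : CommGroup (G ⧸ N) :=
    { (inferInstance : Group (G ⧸ N)) with
      mul_comm := fun x y => by
        obtain ⟨x, rfl⟩ := QuotientGroup.mk'_surjective N x
        obtain ⟨y, rfl⟩ := QuotientGroup.mk'_surjective N y
        rw [← commutatorElement_eq_one_iff_mul_comm, ← map_commutatorElement]
        exact (QuotientGroup.eq_one_iff _).mpr (hN (Subgroup.commutator_mem_commutator
          (Subgroup.mem_top _) (Subgroup.mem_top _))) }
  have : Module.Finite ℤ (Additive (G ⧸ N)) := Module.Finite.iff_addGroup_fg.mpr inferInstance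
  obtain ⟨f, hf, hfa⟩ := AddCommGroup.exists_surjective_int_hom
    (a := Additive.ofMul (QuotientGroup.mk' N a)) (fun n hn h => ha n hn (by
      rw [← QuotientGroup.eq_one_iff]
      exact h))
  refine ⟨(AddMonoidHom.toMultiplicativeRight f).comp (QuotientGroup.mk' N), ?_, ?_, ?_⟩
  · intro n
    obtain ⟨x, hx⟩ := hf n.toAdd
    obtain ⟨y, hy⟩ := QuotientGroup.mk'_surjective N x.toMul
    refine ⟨y, ?_⟩
    rw [MonoidHom.comp_apply, hy]
    exact congrArg Multiplicative.ofAdd hx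
  · intro x hx
    rw [MonoidHom.mem_ker, MonoidHom.comp_apply,
      show QuotientGroup.mk' N x = 1 from (QuotientGroup.eq_one_iff x).mpr hx, map_one]
  · intro h
    exact hfa (congrArg Multiplicative.toAdd h)

/-- If `K < M`, some `g ∈ M` has no positive power in `K ⊔ ⁅M, M⁆`, as otherwise every element of
`M` would have a power in `K`. A surjection `M → ℤ` killing `K` but not `g` then has a smaller
kernel. That kernel is root-closed in `M` because `ℤ` is torsion-free, so the rank drops and the
descent ends. -/
theorem exists_chain_of_root_closed {G : Type*} [Group G] [Group.FG G] [Group.IsNilpotent G]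
    (K : Subgroup G) (hK : ∀ (g : G) (n : ℕ), 0 < n → g ^ n ∈ K → g ∈ K) :
    ∃ (n : ℕ) (L : ℕ → Subgroup G),
      L 0 = ⊤ ∧ L n = K ∧ ∀ i < n, IsInfCyclicStep (L (i + 1)) (L i) := by
  obtain ⟨r, hr, hrs⟩ := (HasCyclicNormalSeries.top (G := G)).exists_rank
  suffices H : ∀ (d : ℕ) (M : Subgroup G), K ≤ M → r M = d → ∃ (n : ℕ) (L : ℕ → Subgroup G),
      L 0 = M ∧ L n = K ∧ ∀ i < n, IsInfCyclicStep (L (i + 1)) (L i) from H _ ⊤ le_top rfl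
  intro d
  induction d using Nat.strong_induction_on with
  | _ d ih =>
    intro M hKM hd
    by_cases hMK : M = K
    · exact ⟨0, fun _ => M, rfl, hMK, by simp⟩
    have : Group.FG M := Group.FG.subgroup_of_isNilpotent M
    obtain ⟨g, hg⟩ : ∃ g : M, ∀ m : ℕ, 0 < m → g ^ m ∉ K.subgroupOf M ⊔ commutator M := by
      by_contra! h
      refine hMK (le_antisymm (fun x hx => ?_) hKM)
      obtain ⟨m, hm, hxm⟩ := exists_pow_mem_of_isNilpotent (K.subgroupOf M) h ⟨x, hx⟩
      exact hK x m hm (by simpa [Subgroup.mem_subgroupOf] using hxm)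
    obtain ⟨f, hf, hker, hfg⟩ := exists_surjective_int_hom le_sup_right hg
    let M₁ := f.ker.map M.subtype
    have hM₁ : M₁ ≤ M := Subgroup.map_subtype_le _
    have hM₁M : M₁.subgroupOf M = f.ker := by
      rw [Subgroup.subgroupOf, Subgroup.comap_map_eq_self_of_injective M.subtype_injective]
    have hKM₁ : K ≤ M₁ := fun x hx =>
      ⟨⟨x, hKM hx⟩, hker (le_sup_left (b := commutator M) hx), rfl⟩
    have hmem : ∀ x : M, (x : G) ∈ M₁ ↔ f x = 1 := fun x => by
      rw [← Subgroup.mem_subgroupOf, hM₁M, MonoidHom.mem_ker]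
    have hstep : IsInfCyclicStep M₁ M := by
      have hn : (M₁.subgroupOf M).Normal := by rw [hM₁M]; infer_instance
      refine ⟨hM₁, hn, ?_⟩
      exact ⟨(QuotientGroup.quotientMulEquivOfEq hM₁M).trans
        (QuotientGroup.quotientKerEquivOfSurjective f hf)⟩
    have hlt : r M₁ < d := by
      rw [← hd]
      refine lt_of_le_of_ne (hr hM₁) fun heq => ?_
      have h1 := hrs M₁ M hM₁ (fun x hx n hn hxn => by
        have h2 := (hmem (⟨x, hx⟩ ^ n)).mp (by simpa using hxn)
        rw [map_pow] at h2
        exact (hmem ⟨x, hx⟩).mpr ((pow_eq_one_iff_left hn.ne').mp h2)) heq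
      exact hfg ((hmem g).mp (h1 ⟨g.2, Subgroup.mem_top _⟩))
    obtain ⟨n, L, hL0, hLn, hL⟩ := ih _ hlt M₁ hKM₁ rfl
    refine ⟨n + 1, fun i => Nat.casesOn i M L, rfl, hLn, ?_⟩
    rintro (_ | i) hi
    · simpa [hL0] using hstep
    · exact hL i (by omega)

end RootClosed

/-! ### Quasimorphisms on nilpotent groups -/

section Quasimorphism

theorem nonpos_of_forall_natCast_mul_le {x D : ℝ} (h : ∀ n : ℕ, n * x ≤ D) : x ≤ 0 := by
  by_contra! hx
  obtain ⟨n, hn⟩ := exists_nat_gt (D / x)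
  rw [div_lt_iff₀ hx] at hn
  exact absurd (h n) hn.not_ge

theorem eq_of_forall_natCast_mul_abs_sub_le {x y D : ℝ} (h : ∀ n : ℕ, |n * x - n * y| ≤ D) :
    x = y := by
  have h1 : ∀ n : ℕ, n * |x - y| ≤ D := fun n => by
    have := h n
    rwa [← mul_sub, abs_mul, Nat.abs_cast] at this
  exact sub_eq_zero.mp (abs_nonpos_iff.mp (nonpos_of_forall_natCast_mul_le h1))

/-- A quasimorphism lies at bounded distance from a homogeneous one. -/
theorem exists_homogeneous_quasimorphism {K : Type*} [Group K] (f : K → ℝ)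
    (hf : ∀ g h, |f (g * h) - f g - f h| ≤ 1) :
    ∃ τ : K → ℝ, (∀ g (n : ℕ), τ (g ^ n) = n * τ g) ∧ ∀ g, |τ g - f g| ≤ 1 := by
  have hpow : ∀ g (n : ℕ), |f (g ^ (n + 1)) - (n + 1) * f g| ≤ n := by
    intro g n
    induction n with
    | zero => simp
    | succ n ih =>
      have h1 := hf (g ^ (n + 1)) g
      rw [← pow_succ] at h1
      rw [abs_le] at *
      push_cast
      constructor <;> linarith
  have hlim : ∀ g, ∃ l : ℝ, Filter.Tendsto (fun n : ℕ => f (g ^ n) / n) Filter.atTop (nhds l) := by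
    intro g
    -- Adding the defect `1` gives subadditivity, so Fekete's lemma yields the limit.
    have hsub : Subadditive fun n : ℕ => f (g ^ n) + 1 := by
      intro m n
      have h1 := hf (g ^ m) (g ^ n)
      rw [← pow_add, abs_le] at h1
      linarith
    have hbdd : BddBelow (Set.range fun n : ℕ => (f (g ^ n) + 1) / n) := by
      refine ⟨min 0 (f g - 1), ?_⟩
      rintro _ ⟨n, rfl⟩
      rcases n with _ | n
      · simp
      · refine (min_le_right _ _).trans ?_
        have h1 := hpow g n
        rw [abs_le] at h1
        rw [le_div_iff₀ (by positivity)]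
        push_cast
        linarith
    refine ⟨hsub.lim, ?_⟩
    have h1 := (hsub.tendsto_lim hbdd).sub tendsto_one_div_atTop_nhds_zero_nat
    rw [sub_zero] at h1
    refine h1.congr fun n => ?_
    rw [← sub_div, add_sub_cancel_right]
  choose τ hτ using hlim
  refine ⟨τ, fun g n => ?_, fun g => ?_⟩
  · rcases n with _ | n
    · have h1 := hτ (g ^ 0)
      simp only [pow_zero, one_pow] at h1
      have h2 := tendsto_const_div_atTop_nhds_zero_nat (f 1)
      simp [tendsto_nhds_unique h1 h2]
    · have h1 : Filter.Tendsto (fun k : ℕ => (n + 1) * k) Filter.atTop Filter.atTop :=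
        Filter.tendsto_id.const_mul_atTop' n.succ_pos
      have h2 := ((hτ g).comp h1).const_mul ((n + 1 : ℕ) : ℝ)
      refine tendsto_nhds_unique (hτ (g ^ (n + 1))) (h2.congr fun k => ?_)
      simp only [Function.comp_apply, ← pow_mul]
      push_cast
      rw [← mul_div_assoc, mul_div_mul_left]
      positivity
  · have h1 : Filter.Tendsto (fun n : ℕ => |f (g ^ n) / n - f g|) Filter.atTop
        (nhds |τ g - f g|) := ((hτ g).sub_const _).abs
    refine le_of_tendsto h1 (Filter.eventually_atTop.mpr ⟨1, fun n hn => ?_⟩)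
    obtain ⟨n, rfl⟩ := Nat.exists_eq_add_of_le' hn
    have h2 := hpow g n
    have h3 : (0 : ℝ) < ((n + 1 : ℕ) : ℝ) := by positivity
    rw [div_sub' h3.ne', abs_div, abs_of_pos h3, div_le_one h3]
    push_cast
    linarith

/-- A homogeneous quasimorphism on a nilpotent group is a homomorphism. -/
theorem map_mul_of_homogeneous_quasimorphism {K : Type*} [Group K] [Group.IsNilpotent K]
    {τ : K → ℝ} {D : ℝ} (hpow : ∀ g (n : ℕ), τ (g ^ n) = n * τ g)
    (hD : ∀ g h, |τ (g * h) - τ g - τ h| ≤ D) (g h : K) : τ (g * h) = τ g + τ h := by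
  have hone : τ 1 = 0 := by simpa using hpow 1 0
  -- By homogeneity `n` times the error at `(g, h)` is the error at `(g ^ n, h ^ n)`, which stays
  -- bounded by `D`.
  have hadd : ∀ g h, (∀ n : ℕ, τ ((g * h) ^ n) = τ (g ^ n * h ^ n)) → τ (g * h) = τ g + τ h := by
    intro g h H
    refine eq_of_forall_natCast_mul_abs_sub_le (D := D) fun n => ?_
    have h1 := hD (g ^ n) (h ^ n)
    rwa [← H, hpow, hpow, hpow, sub_sub, ← mul_add] at h1
  have hcomm : ∀ g h, Commute g h → τ (g * h) = τ g + τ h := fun g h H =>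
    hadd g h fun n => by rw [H.mul_pow]
  have hinv : ∀ g, τ g⁻¹ = -τ g := fun g => by
    have := hcomm g g⁻¹ (Commute.inv_right rfl)
    rw [mul_inv_cancel, hone] at this
    linarith
  have hconj : ∀ g h, τ (h * g * h⁻¹) = τ g := by
    intro g h
    refine eq_of_forall_natCast_mul_abs_sub_le (D := D + D) fun n => ?_
    have h1 := hD (h * g ^ n) h⁻¹
    have h2 := hD h (g ^ n)
    rw [conj_pow.symm, hpow (h * g * h⁻¹), hinv] at h1
    rw [hpow g] at h2
    rw [abs_le] at *
    constructor <;> linarith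
  have hcyc : ∀ g h, τ (g * h) = τ (h * g) := fun g h => by
    rw [← hconj (h * g) g]
    congr 1
    group
  let A : Subgroup K :=
    { carrier := {a | ∀ x, τ (x * a) = τ x + τ a}
      one_mem' := fun x => by simp [hone]
      mul_mem' := fun {a b} ha hb x => by
        rw [← mul_assoc, hb, ha, hb a, add_assoc]
      inv_mem' := fun {a} ha x => by
        have := ha (x * a⁻¹)
        rw [inv_mul_cancel_right] at this
        rw [hinv]
        linarith }
  have hA : ∀ a ∈ A, ∀ x, τ (x * a) = τ x + τ a := fun a ha => ha
  -- Changing an argument by an element of `N` does not change `τ`, so `τ` is additive on pairs that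
  -- merely commute modulo `N`.
  let N : Subgroup K :=
    { carrier := {a | a ∈ A ∧ τ a = 0}
      one_mem' := ⟨A.one_mem, hone⟩
      mul_mem' := fun {a b} ha hb => ⟨A.mul_mem ha.1 hb.1, by rw [hA b hb.1, ha.2, hb.2, add_zero]⟩
      inv_mem' := fun {a} ha => ⟨A.inv_mem ha.1, by rw [hinv, ha.2, neg_zero]⟩ }
  have hN : N.Normal := ⟨fun a ha x => by
    refine ⟨fun y => ?_, by rw [hconj]; exact ha.2⟩
    rw [hconj a x, ← hconj (y * (x * a * x⁻¹)) x⁻¹, ← hconj y x⁻¹, ← hA a ha.1]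
    congr 1
    group⟩
  have hcommN : ∀ g h, ⁅g, h⁆ ∈ N → τ (g * h) = τ g + τ h := by
    intro g h H
    refine hadd g h fun n => ?_
    let q := QuotientGroup.mk' N
    have hq : Commute (q g) (q h) := by
      rw [commute_iff_eq, ← commutatorElement_eq_one_iff_mul_comm, ← map_commutatorElement]
      exact (QuotientGroup.eq_one_iff _).mpr H
    have h1 : (g ^ n * h ^ n)⁻¹ * (g * h) ^ n ∈ N := by
      rw [← QuotientGroup.eq_one_iff]
      change q _ = 1
      simp only [map_mul, map_inv, map_pow, hq.mul_pow]
      group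
    have h2 := hA _ h1.1 (g ^ n * h ^ n)
    rwa [mul_inv_cancel_left, h1.2, add_zero] at h2
  -- For `a` one level up, `⁅a, x⁆ ∈ A` by induction, and conjugation invariance forces `τ ⁅a, x⁆ =
  -- 0`; thus `⁅a, x⁆ ∈ N`.
  have hZ : ∀ n, Subgroup.upperCentralSeries K n ≤ A := by
    intro n
    induction n with
    | zero => simp
    | succ n ih =>
      intro a ha x
      rw [hcyc, add_comm]
      refine hcommN a x ?_
      have h1 : ⁅a, x⁆ ∈ A := ih (Subgroup.mem_upperCentralSeries_succ_iff.mp ha x)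
      refine ⟨h1, ?_⟩
      have h2 : a = ⁅a, x⁆ * (x * a * x⁻¹) := by rw [commutatorElement_def]; group
      have h3 : τ a = τ a + τ ⁅a, x⁆ := by
        conv_lhs => rw [h2, hcyc, hA _ h1, hconj]
      linarith
  obtain ⟨n, hn⟩ := Group.IsNilpotent.nilpotent K
  exact hA h (hZ n (hn ▸ Subgroup.mem_top h)) g

theorem exists_hom_of_quasimorphism {K : Type*} [Group K] [Group.IsNilpotent K] (f : K → ℤ)
    (hf : ∀ g h, |f (g * h) - f g - f h| ≤ 1) {c : K} (hc : ∀ n : ℕ, f (c ^ n) = n) :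
    ∃ τ : K →* Multiplicative ℝ, τ c = Multiplicative.ofAdd 1 := by
  obtain ⟨τ, hpow, hτ⟩ := exists_homogeneous_quasimorphism (fun g => (f g : ℝ))
    fun g h => by exact_mod_cast hf g h
  -- The defect `1` of `f`, plus an error of at most `1` for each of three values.
  have hD : ∀ g h, |τ (g * h) - τ g - τ h| ≤ 4 := fun g h => by
    have h1 := hτ g
    have h2 := hτ h
    have h3 := hτ (g * h)
    have h4 : |(f (g * h) : ℝ) - f g - f h| ≤ 1 := by exact_mod_cast hf g h
    rw [abs_le] at *
    constructor <;> linarith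
  refine ⟨MonoidHom.mk' (fun g => Multiplicative.ofAdd (τ g)) fun g h => ?_, ?_⟩
  · rw [map_mul_of_homogeneous_quasimorphism hpow hD, ofAdd_add]
  · refine congrArg Multiplicative.ofAdd (eq_of_forall_natCast_mul_abs_sub_le (D := 1) fun n => ?_)
    have h1 := hτ (c ^ n)
    rwa [hpow, hc, Int.cast_natCast, ← mul_one (n : ℝ), mul_assoc, one_mul] at h1

end Quasimorphism

/-! ### Monotone actions on linear orders -/

section OrderAction

variable {X : Type*} [LinearOrder X]

/-- The iterates of `x` under `g` move in one direction, so `g • x` lies between `x` and `g ^ n •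
x`. This is what makes the stabilizer root-closed. -/
theorem mem_of_pow_mem_of_monotone_action {G : Type*} [Group G] [MulAction G X]
    (hmono : ∀ g : G, StrictMono (g • · : X → X)) {S : Set X} {x : X} (hx : x ∉ S) {g : G} {n : ℕ}
    (hn : 0 < n) (hg : ∀ p ∈ S, p ∉ Set.uIcc x (g ^ n • x)) : ∀ p ∈ S, p ∉ Set.uIcc x (g • x) := by
  obtain ⟨n, rfl⟩ := Nat.exists_eq_add_of_le' hn
  have hsucc : ∀ k : ℕ, g ^ (k + 1) • x = g ^ k • (g • x) := fun k => by
    rw [pow_succ, mul_smul]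
  intro p hp hpx
  refine hg p hp ?_
  rcases lt_trichotomy x (g • x) with h | h | h
  · have h1 : ∀ k : ℕ, g • x ≤ g ^ (k + 1) • x := by
      intro k
      induction k with
      | zero => simp
      | succ k ih => exact ih.trans (hsucc (k + 1) ▸ ((hmono (g ^ (k + 1))) h).le)
    rw [Set.uIcc_of_le h.le] at hpx
    rw [Set.uIcc_of_le (h.le.trans (h1 n))]
    exact ⟨hpx.1, hpx.2.trans (h1 n)⟩
  · rw [← h, Set.uIcc_self] at hpx
    exact absurd (Set.mem_singleton_iff.mp hpx ▸ hp) hx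
  · have h1 : ∀ k : ℕ, g ^ (k + 1) • x ≤ g • x := by
      intro k
      induction k with
      | zero => simp
      | succ k ih => exact ((hsucc (k + 1)).trans_le ((hmono (g ^ (k + 1))) h).le).trans ih
    rw [Set.uIcc_of_ge h.le] at hpx
    rw [Set.uIcc_of_ge ((h1 n).trans h.le)]
    exact ⟨(h1 n).trans hpx.1, hpx.2⟩

/-- If a central element of a nilpotent group acts cofinally on an orbit, then some real character
does not vanish on it. -/
theorem exists_hom_of_cofinal_action {K : Type*} [Group K] [Group.IsNilpotent K] [MulAction K X]
    (hmono : ∀ g : K, StrictMono (g • · : X → X)) {c : K} (hc : ∀ g, Commute c g) {x : X}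
    (hx : x < c • x) (hcof : ∀ g : K, ∃ n : ℤ, c ^ n • x ≤ g • x ∧ g • x < c ^ (n + 1) • x) :
    ∃ τ : K →* Multiplicative ℝ, τ c = Multiplicative.ofAdd 1 := by
  -- `f g` is the number of `c`-steps from `x` to `g • x`. As `c` is central, the brackets for `g`
  -- and `h` add up, which leaves a defect of at most `1`.
  choose f hf using hcof
  have hpos : StrictMono fun n : ℤ => c ^ n • x := strictMono_int_of_lt_succ fun n => by
    rw [zpow_add_one, mul_smul]
    exact hmono (c ^ n) hx
  have hlt : ∀ m n : ℤ, c ^ m • x < c ^ n • x → m < n := fun m n h => hpos.lt_iff_lt.mp h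
  have hswap : ∀ (g : K) (n : ℤ), g • c ^ n • x = c ^ n • g • x := fun g n => by
    rw [smul_smul, smul_smul, ((hc g).zpow_left n).eq]
  refine exists_hom_of_quasimorphism f (fun g h => ?_) (fun n => ?_)
  · have h1 : c ^ (f g + f h) • x ≤ (g * h) • x := by
      rw [mul_smul, add_comm, zpow_add, mul_smul]
      calc c ^ f h • c ^ f g • x ≤ c ^ f h • g • x := (hmono _).monotone (hf g).1
        _ = g • c ^ f h • x := (hswap _ _).symm
        _ ≤ g • h • x := (hmono _).monotone (hf h).1
    have h2 : (g * h) • x < c ^ (f g + 1 + (f h + 1)) • x := by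
      rw [mul_smul, add_comm, zpow_add, mul_smul]
      calc g • h • x < g • c ^ (f h + 1) • x := hmono _ (hf h).2
        _ = c ^ (f h + 1) • g • x := hswap _ _
        _ < c ^ (f h + 1) • c ^ (f g + 1) • x := hmono _ (hf g).2
    have h3 := hlt _ _ (h1.trans_lt (hf (g * h)).2)
    have h4 := hlt _ _ ((hf (g * h)).1.trans_lt h2)
    rw [abs_le]
    omega
  · have h2 : f (c ^ n) ≤ n := hpos.le_iff_le.mp (by simpa using (hf (c ^ n)).1)
    have h3 := hlt n (f (c ^ n) + 1) (by simpa using (hf (c ^ n)).2)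
    omega

end OrderAction

/-! ### Support intervals and their stabilizers -/

section Interval

open Filter Topology

/-- Iterates that never pass `y` would increase to a limit in `[x, y]`, a fixed point by continuity.
-/
theorem exists_lt_iterate_of_forall_not_isFixedPt {f : unitInterval → unitInterval}
    (hf : Continuous f) (hm : Monotone f) {x y : unitInterval} (hx : x ≤ f x)
    (hfix : ∀ p ∈ Set.Icc x y, f p ≠ p) : ∃ n : ℕ, y < f^[n] x := by
  by_contra! h
  have hmn : Monotone fun n : ℕ => f^[n] x := hm.monotone_iterate_of_le_map hx
  have ht := tendsto_atTop_ciSup hmn (OrderTop.bddAbove _)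
  have hL := isFixedPt_of_tendsto_iterate ht hf.continuousAt
  exact hfix _ ⟨le_ciSup (f := fun n : ℕ => f^[n] x) (OrderTop.bddAbove _) 0, ciSup_le h⟩ hL

theorem exists_iterate_lt_of_forall_not_isFixedPt {f : unitInterval → unitInterval}
    (hf : Continuous f) (hm : Monotone f) {x y : unitInterval} (hx : f x ≤ x)
    (hfix : ∀ p ∈ Set.Icc y x, f p ≠ p) : ∃ n : ℕ, f^[n] x < y := by
  by_contra! h
  have hmn : Antitone fun n : ℕ => f^[n] x := hm.antitone_iterate_of_map_le hx
  have ht := tendsto_atTop_ciInf hmn (OrderBot.bddBelow _)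
  have hL := isFixedPt_of_tendsto_iterate ht hf.continuousAt
  exact hfix _ ⟨le_ciInf h, ciInf_le (f := fun n : ℕ => f^[n] x) (OrderBot.bddBelow _) 0⟩ hL

theorem mem_connectedComponentIn_compl_iff {S : Set unitInterval} {x y : unitInterval}
    (hx : x ∉ S) : y ∈ connectedComponentIn Sᶜ x ↔ ∀ p ∈ S, p ∉ Set.uIcc x y := by
  constructor
  · intro hy p hp hpu
    have h1 := (isPreconnected_connectedComponentIn (x := x) (F := Sᶜ)).ordConnected.uIcc_subset
      (mem_connectedComponentIn (F := Sᶜ) hx) hy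
    exact connectedComponentIn_subset _ _ (h1 hpu) hp
  · intro h
    exact (isPreconnected_uIcc).subset_connectedComponentIn Set.left_mem_uIcc
      (fun p hp hpS => h p hpS hp) Set.right_mem_uIcc

variable {G : Type*} [Group G] (φ : G →* HomeoPlus)

/-- The action on `[0,1]` defined by a homomorphism to `HomeoPlus`. -/
abbrev HomeoPlus.mulAction : MulAction G unitInterval where
  smul g t := (φ g).1 t
  one_smul t := by
    change (φ 1).1 t = t
    rw [map_one]; rfl
  mul_smul g h t := by
    change (φ (g * h)).1 t = (φ g).1 ((φ h).1 t)
    rw [map_mul]; rfl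

theorem HomeoPlus.apply_mem_fixedPoints {c : G} (hc : c ∈ Subgroup.center G) (g : G)
    {p : unitInterval} (hp : p ∈ Function.fixedPoints (φ c).1) :
    (φ g).1 p ∈ Function.fixedPoints (φ c).1 := by
  let _ := HomeoPlus.mulAction φ
  change c • g • p = g • p
  have : c • p = p := hp
  rw [smul_smul, ← Subgroup.mem_center_iff.mp hc g, mul_smul, this]

theorem HomeoPlus.uIcc_apply (g : G) (x y : unitInterval) :
    (φ g).1 '' Set.uIcc x y = Set.uIcc ((φ g).1 x) ((φ g).1 y) := by
  let e : unitInterval ≃o unitInterval := StrictMono.orderIsoOfSurjective (φ g).1 (φ g).2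
    (φ g).1.surjective
  have h := e.image_Icc (x ⊓ y) (x ⊔ y)
  rw [e.map_inf, e.map_sup] at h
  exact h

/-- Elements of `G` preserve the fixed set of `c`. Passing to the closure is harmless: a fixed point
`p` between `x` and `g x` bounds the closed component, which would force `g x = p`, although `g x`
is not fixed by `c`. -/
theorem mem_intervalStab_iff {c : G} (hc : c ∈ Subgroup.center G) {x : unitInterval}
    (hx : x ∉ Function.fixedPoints (φ c).1) (g : G) :
    g ∈ intervalStab φ (closure (connectedComponentIn (Function.fixedPoints (φ c).1)ᶜ x)) ↔
      ∀ p ∈ Function.fixedPoints (φ c).1, p ∉ Set.uIcc x ((φ g).1 x) := by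
  let _ := HomeoPlus.mulAction φ
  have hmono : ∀ g : G, StrictMono (g • · : unitInterval → unitInterval) := fun g => (φ g).2
  set S := Function.fixedPoints (φ c).1 with hS
  have hinvS : ∀ (g : G) (p : unitInterval), g • p ∈ S → p ∈ S := fun g p hp => by
    have := HomeoPlus.apply_mem_fixedPoints φ hc g⁻¹ hp
    change g⁻¹ • g • p ∈ S at this
    rwa [inv_smul_smul] at this
  constructor
  · intro hg p hp hpu
    have hgJ : (g • · : unitInterval → unitInterval) '' closure (connectedComponentIn Sᶜ x) =
      closure (connectedComponentIn Sᶜ x) := hg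
    have hgx : g • x ∈ closure (connectedComponentIn Sᶜ x) := by
      rw [← hgJ]
      exact ⟨x, subset_closure (mem_connectedComponentIn (F := Sᶜ) hx), rfl⟩
    have hpx : p ≠ x := fun h => hx (h ▸ hp)
    have hpgx : p ≠ g • x := fun h => hx (hinvS g x (h ▸ hp))
    change p ∈ Set.uIcc x (g • x) at hpu
    rcases Set.mem_uIcc.mp hpu with h | h
    · have h1 : connectedComponentIn Sᶜ x ⊆ Set.Iic p := fun y hy => by
        by_contra h2
        exact (mem_connectedComponentIn_compl_iff hx).mp hy p hp
          (Set.mem_uIcc.mpr (Or.inl ⟨h.1, (not_le.mp h2).le⟩))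
      exact hpgx (le_antisymm h.2 (closure_minimal h1 isClosed_Iic hgx))
    · have h1 : connectedComponentIn Sᶜ x ⊆ Set.Ici p := fun y hy => by
        by_contra h2
        exact (mem_connectedComponentIn_compl_iff hx).mp hy p hp
          (Set.mem_uIcc.mpr (Or.inr ⟨(not_le.mp h2).le, h.2⟩))
      exact hpgx (le_antisymm (closure_minimal h1 isClosed_Ici hgx) h.1)
  · intro hg
    have key : ∀ g : G, (∀ p ∈ S, p ∉ Set.uIcc x (g • x)) → ∀ y ∈ connectedComponentIn Sᶜ x,
        g • y ∈ connectedComponentIn Sᶜ x := by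
      intro g hg y hy
      rw [mem_connectedComponentIn_compl_iff hx] at hy ⊢
      intro p hp hpu
      rcases Set.uIcc_subset_uIcc_union_uIcc (b := g • x) hpu with h | h
      · exact hg p hp h
      · obtain ⟨q, hq, rfl⟩ := (HomeoPlus.uIcc_apply φ g x y).symm ▸ h
        exact hy q (hinvS g q hp) hq
    have hg' : ∀ p ∈ S, p ∉ Set.uIcc x (g⁻¹ • x) := by
      intro p hp hpu
      refine hg (g • p) (HomeoPlus.apply_mem_fixedPoints φ hc g hp) ?_
      have h1 := Set.mem_image_of_mem (φ g).1 hpu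
      rw [HomeoPlus.uIcc_apply, Set.uIcc_comm] at h1
      change g • p ∈ Set.uIcc (g • g⁻¹ • x) (g • x) at h1
      rwa [smul_inv_smul] at h1
    change (φ g).1 '' closure _ = closure _
    rw [(φ g).1.image_closure]
    congr 1
    apply Set.Subset.antisymm
    · rintro _ ⟨y, hy, rfl⟩
      exact key g hg y hy
    · intro y hy
      exact ⟨g⁻¹ • y, key g⁻¹ hg' y hy, smul_inv_smul g y⟩

theorem exists_zpow_smul_le_lt [MulAction G unitInterval]
    (hmono : ∀ g : G, StrictMono (g • · : unitInterval → unitInterval))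
    (hcont : ∀ g : G, Continuous (g • · : unitInterval → unitInterval)) {c : G}
    {x y : unitInterval} (hx : x < c • x) (hy : ∀ p, c • p = p → p ∉ Set.uIcc x y) :
    ∃ n : ℤ, c ^ n • x ≤ y ∧ y < c ^ (n + 1) • x := by
  have hpos : StrictMono fun n : ℤ => c ^ n • x := strictMono_int_of_lt_succ fun n => by
    rw [zpow_add_one, mul_smul]
    exact hmono (c ^ n) hx
  have hup : ∃ n : ℤ, y < c ^ n • x := by
    obtain ⟨n, hn⟩ := exists_lt_iterate_of_forall_not_isFixedPt (hcont c) (hmono c).monotone hx.le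
      (fun p hp hpc => hy p hpc (Set.Icc_subset_uIcc hp))
    exact ⟨n, by rwa [smul_iterate, ← zpow_natCast] at hn⟩
  have hdown : ∃ n : ℤ, c ^ n • x < y := by
    have h1 : c⁻¹ • x < x := by simpa using hmono c⁻¹ hx
    obtain ⟨n, hn⟩ := exists_iterate_lt_of_forall_not_isFixedPt (hcont c⁻¹) (hmono c⁻¹).monotone
      h1.le (fun p hp hpc => hy p (inv_smul_eq_iff.mp hpc).symm (Set.Icc_subset_uIcc' hp))
    exact ⟨-n, by rwa [smul_iterate, inv_pow, ← zpow_natCast, ← zpow_neg] at hn⟩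
  obtain ⟨a, ha⟩ := hup
  obtain ⟨b, hb⟩ := hdown
  obtain ⟨n, hn, hmax⟩ := Int.exists_greatest_of_bdd (P := fun n : ℤ => c ^ n • x ≤ y)
    ⟨a, fun z hz => (hpos.lt_iff_lt.mp (hz.trans_lt ha)).le⟩ ⟨b, hb.le⟩
  refine ⟨n, hn, ?_⟩
  by_contra! h
  have := hmax _ h
  omega

theorem isStabilizerSubgroup_intervalStab [Group.FG G] [Group.IsNilpotent G] {c : G}
    (hc : c ∈ Subgroup.center G) {J : Set unitInterval} (hJ : IsSupportInterval (φ c).1 J) :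
    IsStabilizerSubgroup (intervalStab φ J) c := by
  obtain ⟨x, hx, rfl⟩ := hJ
  let _ := HomeoPlus.mulAction φ
  have hmono : ∀ g : G, StrictMono (g • · : unitInterval → unitInterval) := fun g => (φ g).2
  have hcont : ∀ g : G, Continuous (g • · : unitInterval → unitInterval) :=
    fun g => (φ g).1.continuous
  have hmem := mem_intervalStab_iff φ hc hx
  set K := intervalStab φ (closure (connectedComponentIn (Function.fixedPoints (φ c).1)ᶜ x))
  have hcx : c • x ≠ x := hx
  have hcK : c ∈ K := by
    rw [hmem]
    intro p (hp : c • p = p) (hpu : p ∈ Set.uIcc x (c • x))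
    rcases Set.mem_uIcc.mp hpu with h | h
    · rcases h.1.eq_or_lt with rfl | h1
      · exact hx hp
      · exact absurd (hmono c h1) (not_lt.mpr (hp.trans_le h.2))
    · rcases h.2.eq_or_lt with rfl | h1
      · exact hx hp
      · exact absurd (hmono c h1) (not_lt.mpr (h.1.trans_eq hp.symm))
  have hcomm : ∀ g : K, Commute (⟨c, hcK⟩ : K) g := fun g =>
    Subtype.ext (Subgroup.mem_center_iff.mp hc g).symm
  have hτ : ∃ τ : K →* Multiplicative ℝ, τ ⟨c, hcK⟩ ≠ 1 := by
    rcases lt_or_gt_of_ne hcx.symm with h | h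
    · obtain ⟨τ, hτ⟩ := exists_hom_of_cofinal_action (K := K) (X := unitInterval) (c := ⟨c, hcK⟩)
        (fun g => hmono g) hcomm h
        (fun g => exists_zpow_smul_le_lt (fun g : K => hmono g) (fun g : K => hcont g) h
          (fun p hp => (hmem g).mp g.2 p hp))
      exact ⟨τ, fun h => one_ne_zero (α := ℝ) (congrArg Multiplicative.toAdd (hτ.symm.trans h))⟩
    -- When `c` moves `x` down, its inverse moves `x` up and has the same fixed points.
    · have h' : x < (⟨c, hcK⟩⁻¹ : K) • x := by
        have h1 : x < c⁻¹ • x := by simpa using hmono c⁻¹ h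
        exact h1
      obtain ⟨τ, hτ⟩ := exists_hom_of_cofinal_action (K := K) (X := unitInterval)
        (c := ⟨c, hcK⟩⁻¹) (fun g => hmono g) (fun g => (hcomm g).inv_left) h'
        (fun g => exists_zpow_smul_le_lt (fun g : K => hmono g) (fun g : K => hcont g) h'
          (fun p hp => (hmem g).mp g.2 p (inv_smul_eq_iff.mp hp).symm))
      refine ⟨τ, fun h => one_ne_zero (α := ℝ) ?_⟩
      rw [map_inv, h, inv_one] at hτ
      exact (congrArg Multiplicative.toAdd hτ).symm
  obtain ⟨τ, hτ⟩ := hτ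
  have : Group.FG K := Group.FG.subgroup_of_isNilpotent K
  -- No positive power of `c` lies in `τ.ker`, since `ℝ` is torsion-free; so the real character can
  -- be traded for an integral one.
  obtain ⟨f, hf, -, hfc⟩ := exists_surjective_int_hom
    (Abelianization.commutator_subset_ker τ) (a := (⟨c, hcK⟩ : K)) (fun n hn h => by
      rw [MonoidHom.mem_ker, map_pow] at h
      exact hτ ((pow_eq_one_iff_left hn.ne').mp h))
  refine ⟨hcK, ⟨f.ker, inferInstance, ⟨QuotientGroup.quotientKerEquivOfSurjective f hf⟩, ?_⟩, ?_⟩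
  · rw [eq_bot_iff]
    rintro _ ⟨⟨y, hy, rfl⟩, ⟨n, hn⟩⟩
    have h1 : y = ⟨c, hcK⟩ ^ n := Subtype.ext (by simpa using hn.symm)
    have h2 : f ⟨c, hcK⟩ ^ n = 1 := by
      rw [← map_zpow, ← h1]
      exact hy
    have h3 : n • (f ⟨c, hcK⟩).toAdd = 0 := congrArg Multiplicative.toAdd h2
    rcases smul_eq_zero.mp h3 with h4 | h4
    · rw [h1, h4]
      simp
    · exact absurd (congrArg Multiplicative.ofAdd h4) hfc
  · refine exists_chain_of_root_closed K fun g n hn hg => ?_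
    rw [hmem] at hg ⊢
    exact mem_of_pow_mem_of_monotone_action hmono hx hn hg

end Interval

/-! ### Invariant orders on coset spaces -/

section PositiveCone

variable {G : Type*} [Group G]

/-- `P` is the positive cone of a left-invariant total order on `G ⧸ L`: `x L < y L` if and only
if `x⁻¹ * y ∈ P`. -/
structure IsPositiveCone (P : Set G) (L : Subgroup G) : Prop where
  mul_mem : ∀ {a b}, a ∈ P → b ∈ P → a * b ∈ P
  notMem : ∀ {a}, a ∈ P → a ∉ L
  trichotomy : ∀ a, a ∈ P ∨ a ∈ L ∨ a⁻¹ ∈ P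

namespace IsPositiveCone

variable {P : Set G} {L : Subgroup G}

theorem left_mul_mem (hP : IsPositiveCone P L) {l a : G} (hl : l ∈ L) (ha : a ∈ P) :
    l * a ∈ P := by
  rcases hP.trichotomy (l * a) with h | h | h
  · exact h
  · exact absurd ((L.mul_mem_cancel_left hl).mp h) (hP.notMem ha)
  · have h1 := hP.mul_mem ha h
    rw [mul_inv_rev, mul_inv_cancel_left] at h1
    exact absurd (L.inv_mem hl) (hP.notMem h1)

theorem right_mul_mem (hP : IsPositiveCone P L) {l a : G} (hl : l ∈ L) (ha : a ∈ P) :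
    a * l ∈ P := by
  rcases hP.trichotomy (a * l) with h | h | h
  · exact h
  · exact absurd ((L.mul_mem_cancel_right hl).mp h) (hP.notMem ha)
  · have h1 := hP.mul_mem h ha
    rw [mul_inv_rev, inv_mul_cancel_right] at h1
    exact absurd (L.inv_mem hl) (hP.notMem h1)

theorem exists_linearOrder (hP : IsPositiveCone P L) :
    ∃ _ : LinearOrder (G ⧸ L), ∀ x y : G, (x : G ⧸ L) < y ↔ x⁻¹ * y ∈ P := by
  classical
  let r : G ⧸ L → G ⧸ L → Prop := fun a b => ∃ x y : G, ↑x = a ∧ ↑y = b ∧ x⁻¹ * y ∈ P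
  have hr : ∀ x y : G, r x y ↔ x⁻¹ * y ∈ P := by
    refine fun x y => ⟨?_, fun h => ⟨x, y, rfl, rfl, h⟩⟩
    rintro ⟨x', y', hx, hy, h⟩
    have h1 := hP.right_mul_mem (QuotientGroup.eq.mp hy)
      (hP.left_mul_mem (QuotientGroup.eq.mp hx.symm) h)
    convert h1 using 1
    group
  have hst : IsStrictTotalOrder (G ⧸ L) r :=
    { trichotomous := fun a b => by
        induction a using QuotientGroup.induction_on with | _ x
        induction b using QuotientGroup.induction_on with | _ y
        intro h1 h2
        rw [hr] at h1 h2
        rw [QuotientGroup.eq]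
        rcases hP.trichotomy (x⁻¹ * y) with h | h | h
        · exact absurd h h1
        · exact h
        · rw [mul_inv_rev, inv_inv] at h
          exact absurd h h2
      irrefl := fun a => by
        induction a using QuotientGroup.induction_on with | _ x
        rw [hr, inv_mul_cancel]
        exact fun h => hP.notMem h L.one_mem
      trans := fun a b d => by
        induction a using QuotientGroup.induction_on with | _ x
        induction b using QuotientGroup.induction_on with | _ y
        induction d using QuotientGroup.induction_on with | _ z
        intro h1 h2
        rw [hr] at *
        convert hP.mul_mem h1 h2 using 1
        group }
  exact ⟨linearOrderOfSTO r, hr⟩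

/-- Lexicographic refinement: compare cosets of `L` first and break ties by `f`. -/
theorem extend (hP : IsPositiveCone P L) {L' : Subgroup G} (hL : L' ≤ L)
    (f : L →* Multiplicative ℤ) (hf : ∀ x : L, f x = 1 ↔ (x : G) ∈ L') :
    IsPositiveCone (P ∪ (↑) '' {x : L | 1 < f x}) L' where
  mul_mem := by
    rintro a b (ha | ⟨a, ha, rfl⟩) (hb | ⟨b, hb, rfl⟩)
    · exact Or.inl (hP.mul_mem ha hb)
    · exact Or.inl (hP.right_mul_mem b.2 ha)
    · exact Or.inl (hP.left_mul_mem a.2 hb)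
    · refine Or.inr ⟨a * b, ?_, rfl⟩
      rw [Set.mem_ofPred_eq, map_mul]
      exact one_lt_mul' ha hb
  notMem := by
    rintro a (ha | ⟨a, ha, rfl⟩) h
    · exact hP.notMem ha (hL h)
    · exact ha.ne' ((hf a).mpr h)
  trichotomy := by
    intro a
    rcases hP.trichotomy a with h | h | h
    · exact Or.inl (Or.inl h)
    · rcases lt_trichotomy (f ⟨a, h⟩) 1 with h1 | h1 | h1
      · refine Or.inr (Or.inr (Or.inr ⟨⟨a, h⟩⁻¹, ?_, rfl⟩))
        rw [Set.mem_ofPred_eq, map_inv]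
        exact one_lt_inv'.mpr h1
      · exact Or.inr (Or.inl ((hf _).mp h1))
      · exact Or.inl (Or.inr ⟨⟨a, h⟩, h1, rfl⟩)
    · exact Or.inr (Or.inr (Or.inl h))

end IsPositiveCone

theorem IsInfCyclicStep.exists_hom {A B : Subgroup G} (h : IsInfCyclicStep A B) :
    ∃ f : B →* Multiplicative ℤ, ∀ x : B, f x = 1 ↔ (x : G) ∈ A := by
  obtain ⟨-, hn, ⟨e⟩⟩ := h
  refine ⟨e.toMonoidHom.comp (QuotientGroup.mk' _), fun x => ?_⟩
  rw [← Subgroup.mem_subgroupOf, ← QuotientGroup.eq_one_iff]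
  exact e.map_eq_one_iff

theorem exists_isPositiveCone_of_chain {n : ℕ} {L : ℕ → Subgroup G} (h0 : L 0 = ⊤)
    (hL : ∀ i < n, IsInfCyclicStep (L (i + 1)) (L i)) : ∃ P : Set G, IsPositiveCone P (L n) := by
  induction n with
  | zero =>
    exact ⟨∅, by simp, by simp, fun a => Or.inr (Or.inl (h0 ▸ Subgroup.mem_top a))⟩
  | succ n ih =>
    obtain ⟨P, hP⟩ := ih fun i hi => hL i (by omega)
    obtain ⟨f, hf⟩ := (hL n (by omega)).exists_hom
    exact ⟨_, hP.extend (hL n (by omega)).1 f hf⟩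

/-- The chain orders `G ⧸ K`, and `K / H ≃ ℤ` refines that order. Since `c` has nonzero image in
`ℤ`, its powers are cofinal in `K / H`. A coset below the block is handled through `g⁻¹`, so that
only suprema are needed later. -/
theorem IsStabilizerSubgroup.exists_linearOrder {K : Subgroup G} {c : G}
    (hc1 : c ≠ 1)
    (h : IsStabilizerSubgroup K c) :
    ∃ (H : Subgroup G) (_ : LinearOrder (G ⧸ H)),
      (∀ g : G, StrictMono (g • · : G ⧸ H → G ⧸ H)) ∧
      (∀ k ∈ K, ∀ l ∈ K, ∃ n : ℤ, (l : G ⧸ H) < c ^ n • (k : G ⧸ H)) ∧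
      ∀ g ∉ K, (∀ k ∈ K, (k : G ⧸ H) < g) ∨ ∀ k ∈ K, (k : G ⧸ H) < (g⁻¹ : G) := by
  obtain ⟨hcK, ⟨H, hn, ⟨e⟩, hH⟩, ⟨n, L, h0, hLn, hL⟩⟩ := h
  obtain ⟨P, hP⟩ := exists_isPositiveCone_of_chain h0 hL
  rw [hLn] at hP
  let f : K →* Multiplicative ℤ := e.toMonoidHom.comp (QuotientGroup.mk' H)
  have hf : ∀ x : K, f x = 1 ↔ (x : G) ∈ H.map K.subtype := fun x => by
    rw [← Subgroup.coe_subtype, Subgroup.mem_map_iff_mem K.subtype_injective,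
      ← QuotientGroup.eq_one_iff]
    exact e.map_eq_one_iff
  have hfc : f ⟨c, hcK⟩ ≠ 1 := fun h1 => by
    have h2 : c ∈ H.map K.subtype ⊓ Subgroup.zpowers c :=
      ⟨(hf _).mp h1, Subgroup.mem_zpowers c⟩
    rw [hH] at h2
    exact hc1 (Subgroup.mem_bot.mp h2)
  have hP' := hP.extend (Subgroup.map_subtype_le H) f hf
  obtain ⟨ord, hord⟩ := hP'.exists_linearOrder
  refine ⟨H.map K.subtype, ord, fun g a b => ?_, fun k hk l hl => ?_, fun g hg => ?_⟩
  · induction a using QuotientGroup.induction_on with | _ x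
    induction b using QuotientGroup.induction_on with | _ y
    change (x : G ⧸ H.map K.subtype) < y →
      ((g * x : G) : G ⧸ H.map K.subtype) < ((g * y : G) : G ⧸ H.map K.subtype)
    rw [hord, hord]
    intro h1
    convert h1 using 1
    group
  · obtain ⟨n, hn⟩ : ∃ n : ℤ, (f (⟨l, hl⟩ * ⟨k, hk⟩⁻¹)).toAdd < n * (f ⟨c, hcK⟩).toAdd := by
      have h1 : (f ⟨c, hcK⟩).toAdd ≠ 0 := fun h2 => hfc (congrArg Multiplicative.ofAdd h2)
      generalize (f ⟨c, hcK⟩).toAdd = u at *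
      generalize (f (⟨l, hl⟩ * ⟨k, hk⟩⁻¹)).toAdd = v
      -- The sign turns the product with `u` into `(|v| + 1) * |u|`, which exceeds `v` as `|u| ≥ 1`.
      refine ⟨(|v| + 1) * u.sign, ?_⟩
      rw [mul_assoc, Int.sign_mul_self_eq_abs]
      nlinarith [le_abs_self v, abs_nonneg v, Int.one_le_abs h1]
    refine ⟨n, ?_⟩
    change (l : G ⧸ H.map K.subtype) < ((c ^ n * k : G) : G ⧸ H.map K.subtype)
    rw [hord]
    refine Or.inr ⟨⟨l, hl⟩⁻¹ * (⟨c, hcK⟩ ^ n * ⟨k, hk⟩), ?_, by simp⟩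
    rw [Set.mem_ofPred_eq]
    rw [← Multiplicative.toAdd_lt]
    simp only [map_mul, map_inv, map_zpow, toAdd_mul, toAdd_inv, toAdd_zpow, toAdd_one,
      smul_eq_mul] at hn ⊢
    linarith
  · rcases hP.trichotomy g with h1 | h1 | h1
    · refine Or.inl fun k hk => ?_
      rw [hord]
      exact Or.inl (hP.left_mul_mem (K.inv_mem hk) h1)
    · exact absurd h1 hg
    · refine Or.inr fun k hk => ?_
      rw [hord]
      exact Or.inl (hP.left_mul_mem (K.inv_mem hk) h1)

end PositiveCone

/-! ### Realizing countable ordered sets in the unit interval -/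

section Realization

/-- The monotone extension to `[0,1]` of a self-map of a dense subset. -/
noncomputable def denseExtension {D : Type*} (e : D → unitInterval) (σ : D → D)
    (t : unitInterval) : unitInterval :=
  sSup ((fun d => e (σ d)) '' {d | e d ≤ t})

theorem denseExtension_monotone {D : Type*} (e : D → unitInterval) (σ : D → D) :
    Monotone (denseExtension e σ) := fun _ _ h =>
  sSup_le_sSup (Set.image_mono fun _ hd => le_trans hd h)

variable {D : Type*} [LinearOrder D] {e : D → unitInterval}

theorem denseExtension_apply (he : StrictMono e) {σ : D → D} (hσ : Monotone σ) (d : D) :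
    denseExtension e σ (e d) = e (σ d) := by
  refine IsLUB.sSup_eq (IsGreatest.isLUB ⟨⟨d, le_refl (e d), rfl⟩, ?_⟩)
  rintro _ ⟨d', hd', rfl⟩
  exact he.monotone (hσ (he.le_iff_le.mp hd'))

/-- A monotone map with dense range has no jumps. -/
theorem continuous_denseExtension (he : StrictMono e) (hd : DenseRange e) {σ : D → D}
    (hσ : Monotone σ) (hs : Function.Surjective σ) : Continuous (denseExtension e σ) := by
  refine (denseExtension_monotone e σ).continuous_of_denseRange (hd.mono ?_)
  rintro _ ⟨d, rfl⟩
  obtain ⟨d', rfl⟩ := hs d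
  exact ⟨e d', denseExtension_apply he hσ d'⟩

/-- An action by order automorphisms on a dense subset of `[0,1]` extends to an action by
homeomorphisms. -/
theorem exists_hom_homeoPlus_of_denseRange {G : Type*} [Group G] (he : StrictMono e)
    (hd : DenseRange e) (σ : G → D → D) (hmono : ∀ g, StrictMono (σ g)) (hone : ∀ d, σ 1 d = d)
    (hmul : ∀ g h d, σ (g * h) d = σ g (σ h d)) :
    ∃ φ : G →* HomeoPlus, ∀ g d, (φ g).1 (e d) = e (σ g d) := by
  have hsurj : ∀ g, Function.Surjective (σ g) := fun g d =>
    ⟨σ g⁻¹ d, by rw [← hmul, mul_inv_cancel, hone]⟩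
  have happ : ∀ g d, denseExtension e (σ g) (e d) = e (σ g d) := fun g d =>
    denseExtension_apply he (hmono g).monotone d
  have hcont : ∀ g, Continuous (denseExtension e (σ g)) := fun g =>
    continuous_denseExtension he hd (hmono g).monotone (hsurj g)
  have hcomp : ∀ g h t, denseExtension e (σ (g * h)) t =
      denseExtension e (σ g) (denseExtension e (σ h) t) := by
    intro g h t
    refine congrFun (hd.equalizer (hcont _) ((hcont g).comp (hcont h)) ?_) t
    funext d
    simp only [Function.comp_apply, happ, hmul]
  have hid : ∀ t, denseExtension e (σ 1) t = t := by
    intro t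
    refine congrFun (hd.equalizer (hcont _) continuous_id ?_) t
    funext d
    simp only [Function.comp_apply, happ, hone, id]
  have hleft : ∀ g t, denseExtension e (σ g⁻¹) (denseExtension e (σ g) t) = t := fun g t => by
    rw [← hcomp, inv_mul_cancel, hid]
  have hright : ∀ g t, denseExtension e (σ g) (denseExtension e (σ g⁻¹) t) = t := fun g t => by
    rw [← hcomp, mul_inv_cancel, hid]
  let ψ : G → (unitInterval ≃ₜ unitInterval) := fun g =>
    { toFun := denseExtension e (σ g)
      invFun := denseExtension e (σ g⁻¹)
      left_inv := hleft g
      right_inv := hright g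
      continuous_toFun := hcont g
      continuous_invFun := hcont g⁻¹ }
  refine ⟨MonoidHom.mk' (fun g => ⟨ψ g, (denseExtension_monotone e (σ g)).strictMono_of_injective
    (ψ g).injective⟩) fun g h => ?_, happ⟩
  exact Subtype.ext (Homeomorph.ext (hcomp g h))

theorem exists_strictMono_denseRange (D : Type*) [LinearOrder D] [Countable D] [DenselyOrdered D]
    [NoMinOrder D] [NoMaxOrder D] [Nonempty D] :
    ∃ e : D → unitInterval, StrictMono e ∧ DenseRange e := by
  have hne : Nonempty (Set.Ioo (0 : ℚ) 1) := ⟨⟨1 / 2, by norm_num⟩⟩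
  obtain ⟨i⟩ := Order.iso_of_countable_dense D (Set.Ioo (0 : ℚ) 1)
  refine ⟨fun d => ⟨((i d : ℚ) : ℝ), ?_, ?_⟩, fun a b h => ?_, ?_⟩
  · exact_mod_cast (i d).2.1.le
  · exact_mod_cast (i d).2.2.le
  · have h1 : ((i a : ℚ) : ℝ) < (i b : ℚ) := by exact_mod_cast i.lt_iff_lt.mpr h
    exact h1
  · refine dense_of_exists_between fun a b hab => ?_
    obtain ⟨q, hq1, hq2⟩ := exists_rat_btwn (show (a : ℝ) < b from hab)
    have h0 : (0 : ℝ) < q := a.2.1.trans_lt hq1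
    have h1 : (q : ℝ) < 1 := hq2.trans_le b.2.2
    refine ⟨_, ⟨i.symm ⟨q, by exact_mod_cast h0, by exact_mod_cast h1⟩, rfl⟩, ?_⟩
    simp only [OrderIso.apply_symm_apply]
    exact ⟨hq1, hq2⟩

/-- Realization of a countable ordered `G`-set in `[0,1]`, every point being blown up to a copy of
`ℚ`. -/
theorem exists_realization {G X : Type*} [Group G] [LinearOrder X] [Countable X] [Nonempty X]
    [MulAction G X] (hmono : ∀ g : G, StrictMono (g • · : X → X)) :
    ∃ (φ : G →* HomeoPlus) (e : X → unitInterval), StrictMono e ∧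
      ∀ g x, (φ g).1 (e x) = e (g • x) := by
  -- `X` may have gaps or endpoints; the lexicographic product with `ℚ` has neither, so Cantor's
  -- theorem applies.
  have : Countable (X ×ₗ ℚ) := toLex.surjective.countable
  obtain ⟨e, he, hd⟩ := exists_strictMono_denseRange (X ×ₗ ℚ)
  obtain ⟨φ, hφ⟩ := exists_hom_homeoPlus_of_denseRange he hd
    (fun (g : G) p => toLex (g • (ofLex p).1, (ofLex p).2)) (fun g p q hpq => by
      rw [Prod.Lex.lt_iff] at hpq ⊢
      exact hpq.imp (fun h => hmono g h) (fun h => ⟨congrArg (g • ·) h.1, h.2⟩))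
    (fun p => by simp) (fun g h p => by simp [mul_smul])
  refine ⟨φ, fun x => e (toLex (x, 0)), fun x y h => he ?_, fun g x => hφ g _⟩
  rw [Prod.Lex.toLex_lt_toLex]
  exact Or.inl h

end Realization

/-- The support interval is taken around the image of the trivial coset. A fixed point of `c`
between two points of the block would block the powers of `c`, which are cofinal there. -/
theorem IsStabilizerSubgroup.exists_action {G : Type*} [Group G] [Countable G] {K : Subgroup G}
    {c : G} (hc : c ∈ Subgroup.center G) (hc1 : c ≠ 1) (h : IsStabilizerSubgroup K c) :
    ∃ (φ : G →* HomeoPlus) (J : Set unitInterval),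
      IsSupportInterval (φ c).1 J ∧ intervalStab φ J = K := by
  have hcK := h.mem
  obtain ⟨H, _, hmono, hcof, hout⟩ := h.exists_linearOrder hc1
  have : Countable (G ⧸ H) := QuotientGroup.mk_surjective.countable
  obtain ⟨φ, e, he, hφ⟩ := exists_realization hmono
  let _ := HomeoPlus.mulAction φ
  have hφ' : ∀ (g : G) x, g • e x = e (g • x) := hφ
  have hstrict : ∀ g : G, StrictMono (g • · : unitInterval → unitInterval) := fun g => (φ g).2
  have hx : e ((1 : G) : G ⧸ H) ∉ Function.fixedPoints (φ c).1 := by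
    intro (h1 : c • e ((1 : G) : G ⧸ H) = e ((1 : G) : G ⧸ H))
    rw [hφ'] at h1
    have h2 : c ∈ MulAction.stabilizer G ((1 : G) : G ⧸ H) := he.injective h1
    obtain ⟨n, hn⟩ := hcof 1 K.one_mem 1 K.one_mem
    have h3 : c ^ n ∈ MulAction.stabilizer G ((1 : G) : G ⧸ H) := Subgroup.zpow_mem _ h2 n
    rw [MulAction.mem_stabilizer_iff] at h3
    rw [h3] at hn
    exact lt_irrefl _ hn
  refine ⟨φ, _, ⟨_, hx, rfl⟩, ?_⟩
  set S := intervalStab φ (closure (connectedComponentIn (Function.fixedPoints (φ c).1)ᶜ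
    (e ((1 : G) : G ⧸ H)))) with hS
  have hmem : ∀ g, g ∈ S ↔ _ := mem_intervalStab_iff φ hc hx
  have hfix : ∀ k ∈ K, ∀ l ∈ K, ∀ p, c • p = p → e (k : G ⧸ H) ≤ p → ¬ p ≤ e (l : G ⧸ H) := by
    intro k hk l hl p hp h1 h2
    obtain ⟨n, hn⟩ := hcof k hk l hl
    have h3 : c ^ n ∈ MulAction.stabilizer G p := Subgroup.zpow_mem _ hp n
    have h4 : c ^ n • e (k : G ⧸ H) ≤ c ^ n • p := (hstrict _).monotone h1
    rw [MulAction.mem_stabilizer_iff.mp h3, hφ'] at h4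
    exact absurd (he hn) (h4.trans h2).not_gt
  have hnot : ∀ g : G, (∀ k ∈ K, (k : G ⧸ H) < g) → g ∉ S := by
    intro g hg hgS
    let A : Set unitInterval := (fun k : G => e (k : G ⧸ H)) '' K
    have hA : (c • · : unitInterval → unitInterval) '' A = A := by
      have h1 : ∀ k : G, c • e (k : G ⧸ H) = e ((c * k : G) : G ⧸ H) := fun k => hφ' c k
      apply Set.Subset.antisymm
      · rintro _ ⟨_, ⟨k, hk, rfl⟩, rfl⟩
        exact ⟨c * k, K.mul_mem hcK hk, (h1 k).symm⟩
      · rintro _ ⟨k, hk, rfl⟩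
        refine ⟨_, ⟨c⁻¹ * k, K.mul_mem (K.inv_mem hcK) hk, rfl⟩, ?_⟩
        dsimp only
        rw [h1, mul_inv_cancel_left]
    let i : unitInterval ≃o unitInterval := StrictMono.orderIsoOfSurjective (φ c).1 (φ c).2
      (φ c).1.surjective
    have hlub : IsLUB A (sSup A) := isLUB_sSup A
    have hlub' : IsLUB A (c • sSup A) := by
      have h1 := (OrderIso.isLUB_image' i).mpr hlub
      change IsLUB ((c • · : unitInterval → unitInterval) '' A) (c • sSup A) at h1
      rwa [hA] at h1
    -- `c` permutes the block `A`, hence fixes its supremum, which separates the base point from its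
    -- image under `g`.
    refine (hmem g).mp hgS (sSup A) (hlub'.unique hlub) (Set.Icc_subset_uIcc ⟨?_, ?_⟩)
    · exact hlub.1 ⟨1, K.one_mem, rfl⟩
    · have h1 : (φ g).1 (e ((1 : G) : G ⧸ H)) = e (g : G ⧸ H) := by
        rw [hφ]
        exact congrArg (fun x : G => e (x : G ⧸ H)) (mul_one g)
      rw [h1]
      refine hlub.2 ?_
      rintro _ ⟨k, hk, rfl⟩
      exact (he (hg k hk)).le
  ext g
  constructor
  · intro hg
    by_contra hgK
    rcases hout g hgK with h1 | h1
    · exact hnot g h1 hg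
    · exact hnot g⁻¹ h1 (S.inv_mem hg)
  · intro hg
    rw [hmem]
    intro p hp hpu
    have h1 : (φ g).1 (e ((1 : G) : G ⧸ H)) = e (g : G ⧸ H) := by
      rw [hφ]
      exact congrArg (fun x : G => e (x : G ⧸ H)) (mul_one g)
    rw [h1] at hpu
    rcases Set.mem_uIcc.mp hpu with h2 | h2
    · exact hfix 1 K.one_mem g hg p hp h2.1 h2.2
    · exact hfix g hg 1 K.one_mem p hp h2.1 h2.2

theorem mainTheorem10 {G : Type*} [Group G] [Group.FG G] [Group.IsNilpotent G]
    (htf : ∀ g : G, IsOfFinOrder g → g = 1)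
    (c : G) (hc : c ∈ Subgroup.center G) (hc1 : c ≠ 1) (K : Subgroup G) :
    IsStabilizerSubgroup K c ↔
      ∃ (φ : G →* HomeoPlus) (J : Set unitInterval),
        IsSupportInterval (φ c).1 J ∧ intervalStab φ J = K := by
  have : Countable G := Group.FG.countable_of_isNilpotent
  refine ⟨fun h => h.exists_action hc hc1, ?_⟩
  rintro ⟨φ, J, hJ, rfl⟩
  exact isStabilizerSubgroup_intervalStab φ hc hJ
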